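/- Let $G=\mathbb Z/12\times\mathbb Z/6$ and let $x,y$ be the $72\times72$ binary permutation matrices indexed by $G$ with $x_{g,h}=1$ iff $h=g+(1,0)$ and $y_{g,h}=1$ iff $h=g+(0,1)$. The $[[144,12,12]]$ gross code is the CSS code on 144 data qubits with parity-check matrices $H_X=[A\mid B]$ and $H_Z=[B^{\mathsf T}\mid A^{\mathsf T}]$ over $\mathbb F_2$, where $A=x^3+y+y^2$ and $B=y^3+x+x^2$; its checks are the 144 rows of $H_X$ and $H_Z$. A single-ancilla syndrome extraction circuit (SEC) uses one dedicated ancilla qubit per check. In every round, the ancilla of an $X$-check (resp. $Z$-check) is prepared in $|+\rangle$ (resp. $|0\rangle$), takes part in one CNOT with each data qubit in the support of the check, controlled on the ancilla (resp. on the data qubit), and is then measured in the $X$-basis (resp. $Z$-basis). The SEC is specified by the time steps of all these operations within a round and by the starting times of the rounds, such that no qubit takes part in two operations in the same time step and each ancilla is measured before it is prepared again; successive rounds may otherwise overlap in time. The SEC is non-interleaved if, for all rounds $r,r'$ (equal or not), either every $X$-type CNOT of round $r$ precedes every $Z$-type CNOT of round $r'$ on the same data qubit (for all data qubits), or every $Z$-type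 CNOT of round $r'$ precedes every $X$-type CNOT of round $r$ on the same data qubit (for all data qubits). In the $m$-round $Z$-basis (resp. $X$-basis) memory experiment all data qubits are prepared in $|0\rangle$ (resp. $|+\rangle$), $m$ rounds of the SEC are run, and all data qubits are measured in the $Z$-basis (resp. $X$-basis). Error mechanisms are the individual failures under standard circuit noise: a non-identity one-qubit Pauli after an idle step of a qubit, a non-identity two-qubit Pauli after a CNOT, a preparation of the orthogonal state, or a flipped measurement outcome. The detectors are the parities of the outcomes of a check in two consecutive rounds and, for the checks of the type of the experiment, also the first-round outcome and the parity of the last-round outcome with the value of the check reconstructed from the final data measurements. The logical observables are the logical operators of the type of the experiment, evaluated on the final data measurements. The circuit distance $d_{\mathrm{circ}}$ is the minimum, over the two experiments, of the least number of error mechanisms that together flip no detector but flip at least one logical observable. **Proposition (Gross circuits).** For every non-interleaved single-ancilla SEC for the gross code and every number $m\ge 1$ of rounds in the memory experiments, $$d_{\mathrm{circ}}\le 11 .$$ -/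

import Mathlib

namespace SyndromeExtraction

/-- The two Pauli bases. Also used as the type (`X` or `Z`) of a check. -/
inductive Basis
  | X
  | Z
  deriving DecidableEq

instance : Fintype Basis where
  elems := {.X, .Z}
  complete b := by cases b <;> simp

/-- The opposite basis. -/
def Basis.dual : Basis → Basis
  | .X => .Z
  | .Z => .X

section Circuits

/-- A Pauli operator modulo phase on the qubits `V`: `P .X v = 1` when `P` acts on `v` with an
`X` factor, and `P .Z v = 1` when it acts with a `Z` factor (both, for `Y`). -/
abbrev Pauli (V : Type*) := Basis → V → ZMod 2

/-- Circuit operations: preparation of the `+1` eigenstate of a basis (`Z` gives `|0⟩` and `X`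
gives `|+⟩`), measurement in a basis, CNOT with given control and target, and idling. -/
inductive Gate (V : Type*)
  | prep (b : Basis) (v : V)
  | meas (b : Basis) (v : V)
  | cnot (control target : V)
  | idle (v : V)

/-- The qubits on which an operation acts. -/
def Gate.qubits {V : Type*} : Gate V → Set V
  | .prep _ v => {v}
  | .meas _ v => {v}
  | .cnot c t => {c, t}
  | .idle v => {v}

/-- A circuit assigns to each time step the operations carried out in that step. -/
abbrev Circuit (V : Type*) := ℕ → Set (Gate V)

open Classical in
/-- Propagation of a Pauli operator through one time step: preparations erase it, a CNOT copies
`X` from control to target and `Z` from target to control. -/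
noncomputable def propagate {V : Type*} [Fintype V] (L : Set (Gate V)) (P : Pauli V) : Pauli V
  | .X, v => if ∃ b, Gate.prep b v ∈ L then 0
      else P .X v + ∑ c, if Gate.cnot c v ∈ L then P .X c else 0
  | .Z, v => if ∃ b, Gate.prep b v ∈ L then 0
      else P .Z v + ∑ t, if Gate.cnot v t ∈ L then P .Z t else 0

/-- Circuit noise: the Pauli errors `P` that can follow a failing operation. An idle operation
is followed by a non-identity Pauli, a CNOT by a non-identity two-qubit Pauli, and a preparation
yields the orthogonal state of its basis. A failing measurement leaves no Pauli error: it flips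
its outcome, see `Mechanism.outcomeFlip`. -/
def Gate.IsFault {V : Type*} : Gate V → Pauli V → Prop
  | .prep b v, P => P b = 0 ∧ Function.support (P b.dual) = {v}
  | .meas _ _, P => P = 0
  | .cnot c t, P => P ≠ 0 ∧ ∀ b, Function.support (P b) ⊆ {c, t}
  | .idle v, P => P ≠ 0 ∧ ∀ b, Function.support (P b) ⊆ {v}

/-- An error mechanism of a circuit: one way in which one of its operations can fail. -/
structure Mechanism {V : Type*} (C : Circuit V) where
  time : ℕ
  gate : Gate V
  mem : gate ∈ C time
  error : Pauli V
  isFault : gate.IsFault error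

/-- The Pauli error present just before time step `t`, when only the mechanism `e` occurs. -/
noncomputable def Mechanism.frame {V : Type*} [Fintype V] {C : Circuit V} (e : Mechanism C) :
    ℕ → Pauli V
  | 0 => 0
  | t + 1 => propagate (C t) (e.frame t) + if t = e.time then e.error else 0

open Classical in
/-- Whether `e` flips the outcome of a measurement of `v` in the basis `b` at time `t`: either a
Pauli error anticommuting with the measured one is present, or that measurement itself fails. -/
noncomputable def Mechanism.outcomeFlip {V : Type*} [Fintype V] {C : Circuit V}
    (e : Mechanism C) (t : ℕ) (b : Basis) (v : V) : ZMod 2 :=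
  e.frame t b.dual v + if e.time = t ∧ e.gate = Gate.meas b v then 1 else 0

end Circuits

/-- A CSS code on the data qubits `Q`, given by its parity-check matrices `H .X` and `H .Z`. -/
structure CSSCode (R : Basis → Type*) (Q : Type*) [Fintype Q] where
  H : (b : Basis) → Matrix (R b) Q (ZMod 2)
  comm : H .X * (H .Z).transpose = 0

section Experiments

variable {R : Basis → Type*} {Q : Type*} [Fintype Q]

/-- The checks of the code: the rows of both matrices. -/
abbrev CSSCode.Check (_K : CSSCode R Q) := Σ b : Basis, R b

/-- The data qubits in the support of a check. -/
def CSSCode.support (K : CSSCode R Q) (c : K.Check) : Set Q := {q | K.H c.1 c.2 q = 1}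

/-- The qubits of a single-ancilla circuit: the data qubits and one ancilla for each check. -/
abbrev CSSCode.Qubit (K : CSSCode R Q) := Q ⊕ K.Check

/-- The logical operators of type `b`: supports commuting with all checks of the other type and
not generated by the checks of type `b`. -/
def CSSCode.logicals (K : CSSCode R Q) (b : Basis) : Set (Q → ZMod 2) :=
  {v | (K.H b.dual).mulVec v = 0 ∧ v ∉ Submodule.span (ZMod 2) (Set.range (K.H b))}

/-- A single-ancilla syndrome extraction circuit: for each check, the time steps (relative to the
start of a round) of the ancilla preparation, of the CNOT with each data qubit of the support, and
of the ancilla measurement; and the starting time of each round. Successive rounds may overlap in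
time. A qubit takes part in at most one operation at a time. -/
structure SEC (K : CSSCode R Q) where
  prep : K.Check → ℕ
  /-- Only the values at data qubits in the support of the check matter. -/
  cnot : K.Check → Q → ℕ
  meas : K.Check → ℕ
  start : ℕ → ℕ
  prep_lt_meas : ∀ c, prep c < meas c
  prep_lt_cnot : ∀ c, ∀ q ∈ K.support c, prep c < cnot c q
  cnot_lt_meas : ∀ c, ∀ q ∈ K.support c, cnot c q < meas c
  /-- An ancilla is measured before it is prepared for the next round. -/
  meas_lt_prep : ∀ c r, start r + meas c < start (r + 1) + prep c
  /-- An ancilla takes part in one CNOT at a time. -/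
  ancilla_inj : ∀ c, Set.InjOn (cnot c) (K.support c)
  /-- A data qubit takes part in one CNOT at a time. -/
  data_inj : ∀ c c' q r r', q ∈ K.support c → q ∈ K.support c' →
    start r + cnot c q = start r' + cnot c' q → c = c' ∧ r = r'

namespace SEC

variable {K : CSSCode R Q} (S : SEC K)

/-- The time step of the CNOT between the ancilla of `c` and the data qubit `q` in round `r`. -/
def cnotTime (c : K.Check) (q : Q) (r : ℕ) : ℕ := S.start r + S.cnot c q

/-- All `b`-type CNOTs of round `r` precede all overlapping CNOTs of the opposite type of round
`r'`, where CNOTs overlap when they act on a common data qubit. -/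
def Precedes (b : Basis) (r r' : ℕ) : Prop :=
  ∀ (i : R b) (j : R b.dual) (q : Q), q ∈ K.support ⟨b, i⟩ → q ∈ K.support ⟨b.dual, j⟩ →
    S.cnotTime ⟨b, i⟩ q r < S.cnotTime ⟨b.dual, j⟩ q r'

/-- Non-interleaved circuits: either all `X`-type CNOTs precede all overlapping `Z`-type CNOTs,
or the other way round. As rounds are repeated and may be staggered, this is required both of the
`X`-part and the `Z`-part of one round and of those of two different rounds. -/
def NonInterleaved : Prop :=
  ∀ r r' : ℕ, S.Precedes .X r r' ∨ S.Precedes .Z r' r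

section Memory

variable [∀ b, Fintype (R b)]

/-- The time step of the final data measurements of the `m`-round memory experiment, after all
other operations. (The circuit of the rounds is delayed by one step to prepare the data.) -/
def finish (m : ℕ) : ℕ :=
  ((Finset.range m).sup fun r => Finset.univ.sup fun c => S.start r + S.meas c) + 2

/-- The operations, other than idling, of the `b`-basis memory experiment with `m` rounds. -/
inductive Active (b : Basis) (m : ℕ) : ℕ → Gate K.Qubit → Prop
  | dataPrep (q : Q) : Active b m 0 (.prep b (.inl q))
  | ancillaPrep (c : K.Check) (r : ℕ) (hr : r < m) :
      Active b m (S.start r + S.prep c + 1) (.prep c.1 (.inr c))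
  | cnotX (i : R .X) (q : Q) (r : ℕ) (hr : r < m) (hq : q ∈ K.support ⟨.X, i⟩) :
      Active b m (S.cnotTime ⟨.X, i⟩ q r + 1) (.cnot (.inr ⟨.X, i⟩) (.inl q))
  | cnotZ (j : R .Z) (q : Q) (r : ℕ) (hr : r < m) (hq : q ∈ K.support ⟨.Z, j⟩) :
      Active b m (S.cnotTime ⟨.Z, j⟩ q r + 1) (.cnot (.inl q) (.inr ⟨.Z, j⟩))
  | ancillaMeas (c : K.Check) (r : ℕ) (hr : r < m) :
      Active b m (S.start r + S.meas c + 1) (.meas c.1 (.inr c))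
  | dataMeas (q : Q) : Active b m (S.finish m) (.meas b (.inl q))

/-- The `b`-basis memory experiment with `m` rounds: the data qubits are prepared in `|0⟩`
(or `|+⟩`), `m` rounds of the circuit are run, and the data qubits are measured in the same basis.
A qubit without an operation in a time step idles. -/
def memoryCircuit (b : Basis) (m : ℕ) : Circuit K.Qubit := fun t =>
  {g | S.Active b m t g} ∪
  {g | ∃ v, g = .idle v ∧ t ≤ S.finish m ∧ ∀ g', S.Active b m t g' → v ∉ g'.qubits}

variable {S} {b : Basis} {m : ℕ}

/-- Whether `e` flips the final measurement outcome of the data qubit `q`. -/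
noncomputable def dataFlip (e : Mechanism (S.memoryCircuit b m)) (q : Q) : ZMod 2 :=
  e.outcomeFlip (S.finish m) b (.inl q)

/-- Whether `e` flips the successive values of the check `c`: a reference value, which is never
flipped, then (in position `k + 1`) the ancilla outcomes of the rounds `k < m`, and at last the
value reconstructed from the final data measurements. -/
noncomputable def syndromeFlip (e : Mechanism (S.memoryCircuit b m)) (c : K.Check) : ℕ → ZMod 2
  | 0 => 0
  | k + 1 => if k < m then e.outcomeFlip (S.start k + S.meas c + 1) c.1 (.inr c)
      else ∑ q, K.H c.1 c.2 q * dataFlip e q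

/-- The detectors of the `b`-basis memory experiment, which compare the values of a check in
positions `k` and `k + 1`. The checks of type `b` have a deterministic value at the start and can be
reconstructed at the end; for those of the other type, only consecutive rounds can be compared. -/
def IsDetector (b : Basis) (m : ℕ) (c : K.Check) (k : ℕ) : Prop :=
  if c.1 = b then k ≤ m else 1 ≤ k ∧ k < m

/-- Whether `e` flips the detector `(c, k)`. -/
noncomputable def detectorFlip (e : Mechanism (S.memoryCircuit b m)) (c : K.Check) (k : ℕ) :
    ZMod 2 :=
  syndromeFlip e c (k + 1) + syndromeFlip e c k

/-- Whether `e` flips the logical observable `v`, read off from the final data measurements. -/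
noncomputable def observableFlip (e : Mechanism (S.memoryCircuit b m)) (v : Q → ZMod 2) : ZMod 2 :=
  ∑ q, v q * dataFlip e q

/-- An error configuration that flips no detector but flips at least one logical observable.
(Once no detector is flipped, some logical operator is flipped if and only if a member of any
given basis of logical operators is.) -/
def IsCircuitLogical (E : Finset (Mechanism (S.memoryCircuit b m))) : Prop :=
  (∀ (c : K.Check) (k : ℕ), IsDetector b m c k → ∑ e ∈ E, detectorFlip e c k = 0) ∧
  ∃ v ∈ K.logicals b, ∑ e ∈ E, observableFlip e v ≠ 0

variable (S)

/-- The minimum number of error mechanisms in the `b`-basis memory experiment with `m` rounds that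
flip no detector but flip at least one logical observable (`⊤` if there are none). -/
noncomputable def basisDistance (b : Basis) (m : ℕ) : ℕ∞ :=
  ⨅ (E : Finset (Mechanism (S.memoryCircuit b m))) (_ : IsCircuitLogical E), (E.card : ℕ∞)

/-- The circuit distance, for memory experiments with `m` rounds. -/
noncomputable def circuitDistance (m : ℕ) : ℕ∞ :=
  min (S.basisDistance .X m) (S.basisDistance .Z m)

end Memory

end SEC

end Experiments

section GrossCode

/-- The matrix of `∑ a ∈ s, x ^ a.1 * y ^ a.2` where `x = S₁₂ ⊗ I₆` and `y = I₁₂ ⊗ S₆` are the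
cyclic shifts (`S` has a `1` in row `i` and column `i + 1`). -/
def shiftMatrix (s : Finset (ZMod 12 × ZMod 6)) :
    Matrix (ZMod 12 × ZMod 6) (ZMod 12 × ZMod 6) (ZMod 2) :=
  Matrix.of fun g h => if h - g ∈ s then 1 else 0

theorem shiftMatrix_mul_comm (s t : Finset (ZMod 12 × ZMod 6)) :
    shiftMatrix s * shiftMatrix t = shiftMatrix t * shiftMatrix s := by
  have key : ∀ u : Finset (ZMod 12 × ZMod 6),
      shiftMatrix u = Matrix.circulant fun d => if -d ∈ u then (1 : ZMod 2) else 0 := by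
    intro u
    ext g h
    simp [shiftMatrix, Matrix.circulant_apply]
  rw [key s, key t, Matrix.circulant_mul_comm]

/-- `A = x ^ 3 + y + y ^ 2`. -/
def grossA : Matrix (ZMod 12 × ZMod 6) (ZMod 12 × ZMod 6) (ZMod 2) :=
  shiftMatrix {(3, 0), (0, 1), (0, 2)}

/-- `B = y ^ 3 + x + x ^ 2`. -/
def grossB : Matrix (ZMod 12 × ZMod 6) (ZMod 12 × ZMod 6) (ZMod 2) :=
  shiftMatrix {(0, 3), (1, 0), (2, 0)}

/-- The `[[144, 12, 12]]` gross code: the bivariate bicycle code with `H_X = [A | B]` and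
`H_Z = [Bᵀ | Aᵀ]`. -/
def grossCode : CSSCode (fun _ => ZMod 12 × ZMod 6)
    ((ZMod 12 × ZMod 6) ⊕ (ZMod 12 × ZMod 6)) where
  H
    | .X => Matrix.fromCols grossA grossB
    | .Z => Matrix.fromCols grossB.transpose grossA.transpose
  comm := by
    have h : ∀ M : Matrix (ZMod 12 × ZMod 6) (ZMod 12 × ZMod 6) (ZMod 2), M + M = 0 := by
      intro M
      ext i j
      exact CharTwo.add_self_eq_zero _
    change Matrix.fromCols grossA grossB *
      (Matrix.fromCols grossB.transpose grossA.transpose).transpose = 0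
    rw [Matrix.transpose_fromCols, Matrix.fromCols_mul_fromRows, Matrix.transpose_transpose,
      Matrix.transpose_transpose, grossA, grossB, shiftMatrix_mul_comm, h]

end GrossCode

end SyndromeExtraction

namespace SyndromeExtraction

/-! ### Weight-12 logical operators of the gross code -/

section GrossLogicals

/-! As `circuitDistance` is a minimum, bounding the `Z`-basis experiment suffices. An `X` error on
the ancilla of an `X`-check spreads through its remaining CNOTs, so one fault just before the last
two CNOTs puts `X` errors on their two data qubits `a`, `b` (a hook error). Whatever the order of
the CNOTs, some `X`-logical of weight 12 contains `a` and `b`: this is a finite check for the 15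
pairs in the support of a single check (`grossLogicalsX_pair`). Ten single data faults complete the
hook to that logical, for a total of 1 + 10 = 11.

These faults must also be invisible. Each is an `X` error after an `X`-type CNOT of the first round,
so every data error arises at the time of such a CNOT (`firstRoundFault_frame_data`).
Non-interleaving then forces each round of `Z`-checks to see either the whole error, which has zero
syndrome, or none of it (`firstRoundFault_outcomeFlip_Z`). The outcomes of `X`-checks are
insensitive to `X` errors. An anticommuting `Z`-logical is flipped at the end. -/

instance decidableMemGrossQubits (q : (ZMod 12 × ZMod 6) ⊕ (ZMod 12 × ZMod 6))
    (l : List ((ZMod 12 × ZMod 6) ⊕ (ZMod 12 × ZMod 6))) : Decidable (q ∈ l) :=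
  @List.instDecidableMemOfLawfulBEq _ instBEqOfDecidableEq _ q l

/-- A set of data qubits of the gross code, listed by left and right part. -/
def grossQubits (l r : List (ZMod 12 × ZMod 6)) :
    List ((ZMod 12 × ZMod 6) ⊕ (ZMod 12 × ZMod 6)) :=
  l.map .inl ++ r.map .inr

/-- Supports of seven `X`-type logical operators of weight `12`. -/
def grossLogicalsX : List (List ((ZMod 12 × ZMod 6) ⊕ (ZMod 12 × ZMod 6))) :=
  [grossQubits [(0, 2), (4, 1), (6, 4), (11, 5)]
    [(1, 0), (1, 4), (1, 5), (2, 0), (4, 4), (5, 5), (8, 3), (11, 1)],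
  grossQubits [(0, 1), (0, 5), (1, 3), (1, 5), (2, 0), (11, 0), (11, 5)]
    [(0, 0), (0, 3), (0, 5), (1, 0), (11, 1)],
  grossQubits [(0, 1), (0, 2), (1, 1), (1, 3), (2, 1), (2, 5), (3, 2)]
    [(0, 3), (1, 1), (1, 2), (1, 5), (2, 2)],
  grossQubits [(0, 2), (1, 3), (3, 0), (4, 2), (5, 3), (7, 0)]
    [(1, 0), (1, 5), (2, 1), (5, 0), (6, 1), (9, 5)],
  grossQubits [(0, 1), (1, 2), (5, 3)]
    [(0, 3), (1, 4), (1, 5), (2, 0), (3, 1), (4, 3), (6, 0), (6, 1), (9, 5)],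
  grossQubits [(0, 1), (3, 0), (4, 1), (6, 4), (11, 5)]
    [(0, 3), (1, 4), (1, 5), (4, 4), (5, 5), (8, 3), (11, 1)],
  grossQubits [(2, 3), (3, 0), (4, 0), (4, 3), (5, 0), (6, 0)]
    [(2, 0), (2, 5), (5, 4), (8, 3), (8, 4), (11, 2)]]

/-- The support of a `Z`-type logical operator anticommuting with all of `grossLogicalsX`. -/
def grossLogicalZ : List ((ZMod 12 × ZMod 6) ⊕ (ZMod 12 × ZMod 6)) :=
  grossQubits [(1, 0), (1, 1), (1, 2), (1, 5), (4, 1), (4, 3), (7, 0), (7, 1), (7, 2), (7, 5),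
    (10, 1), (10, 3)] []

/-- The support of the `X`-check at the origin. -/
def grossRow : List ((ZMod 12 × ZMod 6) ⊕ (ZMod 12 × ZMod 6)) :=
  grossQubits [(3, 0), (0, 1), (0, 2)] [(0, 3), (1, 0), (2, 0)]

theorem grossLogicalZ_nodup : grossLogicalZ.Nodup := by decide +kernel

theorem grossLogicalsX_nodup : ∀ V ∈ grossLogicalsX, V.Nodup ∧ V.length = 12 := by
  decide +kernel

theorem grossLogicalZ_check : ∀ i : ZMod 12 × ZMod 6,
    (grossLogicalZ.map fun q => grossCode.H .X i q).sum = 0 := by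
  decide +kernel

theorem grossLogicalsX_check : ∀ V ∈ grossLogicalsX, ∀ j : ZMod 12 × ZMod 6,
    (V.map fun q => grossCode.H .Z j q).sum = 0 := by
  decide +kernel

/-- The odd overlap serves twice: it makes each `V` flip the observable, and, as `V` commutes with
all `Z`-checks, it shows that `grossLogicalZ` is not a product of them. -/
theorem grossLogicals_odd : ∀ V ∈ grossLogicalsX,
    (V.map fun q => if q ∈ grossLogicalZ then (1 : ZMod 2) else 0).sum ≠ 0 := by
  decide +kernel

/-- Six of the seven supports meet the row in three qubits and the last in two; together they cover
all 15 pairs. -/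
theorem grossLogicalsX_pair : ∀ a ∈ grossRow, ∀ b ∈ grossRow, a ≠ b →
    ∃ V ∈ grossLogicalsX, a ∈ V ∧ b ∈ V := by
  decide +kernel

theorem grossCode_mem_support_iff (q : (ZMod 12 × ZMod 6) ⊕ (ZMod 12 × ZMod 6)) :
    q ∈ grossCode.support ⟨.X, (0, 0)⟩ ↔ q ∈ grossRow := by
  change grossCode.H .X (0, 0) q = 1 ↔ q ∈ grossRow
  revert q
  decide +kernel

/-- Provides, for each data qubit, an `X`-type CNOT after which a single data fault can be placed.
-/
theorem grossCode_exists_mem_support (q : (ZMod 12 × ZMod 6) ⊕ (ZMod 12 × ZMod 6)) :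
    ∃ i : ZMod 12 × ZMod 6, q ∈ grossCode.support ⟨.X, i⟩ := by
  rcases q with g | g
  -- The shift comes from the term `x ^ 3` of `A`; on the right part, `y ^ 3` of `B` plays the same
  -- role.
  · refine ⟨g - (3, 0), ?_⟩
    change (if g - (g - (3, 0)) ∈ ({(3, 0), (0, 1), (0, 2)} : Finset (ZMod 12 × ZMod 6))
      then (1 : ZMod 2) else 0) = 1
    simp
  · refine ⟨g - (0, 3), ?_⟩
    change (if g - (g - (0, 3)) ∈ ({(0, 3), (1, 0), (2, 0)} : Finset (ZMod 12 × ZMod 6))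
      then (1 : ZMod 2) else 0) = 1
    simp

end GrossLogicals

/-! ### Propagation of a single error -/

theorem propagate_zero {V : Type*} [Fintype V] (L : Set (Gate V)) :
    propagate L (0 : Pauli V) = 0 := by
  funext b v
  cases b <;> simp [propagate]

/-- The error is added after the propagation of step `e.time`, so it first shows in the frame at
`e.time + 1`. -/
theorem Mechanism.frame_eq_zero {V : Type*} [Fintype V] {C : Circuit V} (e : Mechanism C)
    {t : ℕ} (ht : t ≤ e.time) : e.frame t = 0 := by
  induction t with
  | zero => rfl
  | succ t ih =>
    rw [Mechanism.frame, ih (by omega), propagate_zero, if_neg (by omega), add_zero]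

/-- Errors without a `Z` factor never acquire one. -/
theorem Mechanism.frame_Z_eq_zero {V : Type*} [Fintype V] {C : Circuit V} (e : Mechanism C)
    (he : e.error .Z = 0) (t : ℕ) : e.frame t .Z = 0 := by
  induction t with
  | zero => rfl
  | succ t ih =>
    funext v
    have h : (if t = e.time then e.error else 0) .Z v = 0 := by
      split_ifs
      · rw [he]; rfl
      · rfl
    rw [Mechanism.frame, Pi.add_apply, Pi.add_apply, h]
    simp [propagate, ih]

open Classical in
theorem Mechanism.frame_succ_X {V : Type*} [Fintype V] {C : Circuit V} (e : Mechanism C)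
    (t : ℕ) (v : V) : e.frame (t + 1) .X v =
      (if ∃ b, Gate.prep b v ∈ C t then 0
        else e.frame t .X v + ∑ c, if Gate.cnot c v ∈ C t then e.frame t .X c else 0) +
      if t = e.time then e.error .X v else 0 := by
  rw [Mechanism.frame, Pi.add_apply, Pi.add_apply, propagate]
  congr 1
  split_ifs <;> rfl

/-! ### Operations and ancillas of the memory circuit -/

namespace SEC

variable {R : Basis → Type*} {Q : Type*} [Fintype Q] {K : CSSCode R Q} {S : SEC K}

/-- Rounds may overlap, but the rounds of one ancilla do not; this identifies the round to which an
operation on the ancilla belongs. -/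
theorem start_add_meas_lt (S : SEC K) (c : K.Check) {r r' : ℕ} (h : r < r') :
    S.start r + S.meas c < S.start r' + S.prep c := by
  induction r', h using Nat.le_induction with
  | base => exact S.meas_lt_prep c r
  | succ n _ ih =>
    have := S.meas_lt_prep c n
    have := S.prep_lt_meas c
    omega

variable [∀ b, Fintype (R b)] {b : Basis} {m t : ℕ}

theorem prep_inl_mem_iff (q : Q) (b' : Basis) :
    Gate.prep b' (.inl q) ∈ S.memoryCircuit b m t ↔ t = 0 ∧ b' = b := by
  constructor
  · rintro (h | ⟨v, h, -⟩)
    · cases h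
      exact ⟨rfl, rfl⟩
    · cases h
  · rintro ⟨rfl, rfl⟩
    exact .inl (.dataPrep q)

theorem prep_inr_mem_iff (c : K.Check) (b' : Basis) :
    Gate.prep b' (.inr c) ∈ S.memoryCircuit b m t ↔
      b' = c.1 ∧ ∃ r < m, t = S.start r + S.prep c + 1 := by
  constructor
  · rintro (h | ⟨v, h, -⟩)
    · cases h with
      | ancillaPrep c r hr => exact ⟨rfl, r, hr, rfl⟩
    · cases h
  · rintro ⟨rfl, r, hr, rfl⟩
    exact .inl (.ancillaPrep c r hr)

theorem cnot_inl_mem_iff (v : K.Qubit) (q : Q) :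
    Gate.cnot v (.inl q) ∈ S.memoryCircuit b m t ↔
      ∃ i : R .X, v = .inr ⟨.X, i⟩ ∧ q ∈ K.support ⟨.X, i⟩ ∧
        ∃ r < m, t = S.cnotTime ⟨.X, i⟩ q r + 1 := by
  constructor
  · rintro (h | ⟨v, h, -⟩)
    · cases h with
      | cnotX i q r hr hq => exact ⟨i, rfl, hq, r, hr, rfl⟩
    · cases h
  · rintro ⟨i, rfl, hq, r, hr, rfl⟩
    exact .inl (.cnotX i q r hr hq)

theorem not_cnot_inr_X_mem (v : K.Qubit) (i : R .X) :
    Gate.cnot v (.inr ⟨.X, i⟩) ∉ S.memoryCircuit b m t := by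
  rintro (h | ⟨v, h, -⟩)
  · cases h
  · cases h

theorem cnot_inr_Z_mem_iff (v : K.Qubit) (j : R .Z) :
    Gate.cnot v (.inr ⟨.Z, j⟩) ∈ S.memoryCircuit b m t ↔
      ∃ q, v = .inl q ∧ q ∈ K.support ⟨.Z, j⟩ ∧
        ∃ r < m, t = S.cnotTime ⟨.Z, j⟩ q r + 1 := by
  constructor
  · rintro (h | ⟨v, h, -⟩)
    · cases h with
      | cnotZ j q r hr hq => exact ⟨q, rfl, hq, r, hr, rfl⟩
    · cases h
  · rintro ⟨i, rfl, hq, r, hr, rfl⟩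
    exact .inl (.cnotZ j i r hr hq)

/-- The values of an `X`-ancilla change only when it fails or is prepared. -/
theorem frame_X_ancilla_succ (e : Mechanism (S.memoryCircuit b m)) (i : R .X) (t : ℕ) :
    e.frame (t + 1) .X (.inr ⟨.X, i⟩) =
      (if ∃ r < m, t = S.start r + S.prep ⟨.X, i⟩ + 1 then 0
        else e.frame t .X (.inr ⟨.X, i⟩)) +
      if t = e.time then e.error .X (.inr ⟨.X, i⟩) else 0 := by
  classical
  rw [e.frame_succ_X]
  simp only [prep_inr_mem_iff, not_cnot_inr_X_mem, if_false, Finset.sum_const_zero, add_zero,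
    exists_eq_left]

/-- During a round, the ancilla of a `Z`-check collects the errors of the data qubits at the times
of its CNOTs. -/
theorem frame_Z_ancilla (e : Mechanism (S.memoryCircuit b m)) (j : R .Z)
    (he : e.error .X (.inr ⟨.Z, j⟩) = 0) {r : ℕ} (hr : r < m)
    (h1 : S.start r + S.prep ⟨.Z, j⟩ + 1 < t) (h2 : t ≤ S.start r + S.meas ⟨.Z, j⟩ + 1) :
    e.frame t .X (.inr ⟨.Z, j⟩) = ∑ q, if S.cnotTime ⟨.Z, j⟩ q r + 1 < t then
      K.H .Z j q * e.frame (S.cnotTime ⟨.Z, j⟩ q r + 1) .X (.inl q) else 0 := by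
  classical
  have hH : ∀ (q : Q) (x : ZMod 2),
      K.H .Z j q * x = if q ∈ K.support ⟨.Z, j⟩ then x else 0 := by
    intro q x
    have h01 : ∀ y : ZMod 2, y * x = if y = 1 then x else 0 := by decide +revert
    exact (h01 _).trans (if_congr Iff.rfl rfl rfl)
  have herr : ∀ t, (if t = e.time then e.error .X (.inr ⟨.Z, j⟩) else 0) = 0 := by
    intro t
    rw [he, ite_self]
  induction t, h1 using Nat.le_induction with
  | base =>
    rw [e.frame_succ_X, herr, add_zero, if_pos]
    · refine (Finset.sum_eq_zero fun q _ => ?_).symm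
      rw [hH]
      split_ifs with h h'
      · have := S.prep_lt_cnot _ q h'
        unfold cnotTime at h
        omega
      · rfl
      · rfl
    · exact ⟨.Z, (prep_inr_mem_iff _ _).2 ⟨rfl, r, hr, rfl⟩⟩
  | succ t h1 ih =>
    rw [e.frame_succ_X, herr, add_zero, if_neg, ih (by omega), Fintype.sum_sum_type,
      Finset.sum_eq_zero (s := (Finset.univ : Finset K.Check)), add_zero,
      ← Finset.sum_add_distrib]
    · refine Finset.sum_congr rfl fun q _ => ?_
      rw [hH]
      -- Between the preparation and the measurement of round `r`, the ancilla only takes part in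
      -- CNOTs of that round.
      have hiff : Gate.cnot (.inl q) (.inr ⟨.Z, j⟩) ∈ S.memoryCircuit b m t ↔
          q ∈ K.support ⟨.Z, j⟩ ∧ t = S.cnotTime ⟨.Z, j⟩ q r + 1 := by
        rw [cnot_inr_Z_mem_iff]
        constructor
        · rintro ⟨q', h, hq, r', hr', rfl⟩
          cases h
          refine ⟨hq, ?_⟩
          have h3 := S.prep_lt_cnot _ q hq
          have h4 := S.cnot_lt_meas _ q hq
          unfold cnotTime at *
          rcases lt_trichotomy r r' with h | rfl | h
          · have := S.start_add_meas_lt ⟨.Z, j⟩ h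
            omega
          · rfl
          · have := S.start_add_meas_lt ⟨.Z, j⟩ h
            omega
        · rintro ⟨hq, rfl⟩
          exact ⟨q, rfl, hq, r, hr, rfl⟩
      simp only [hiff]
      by_cases hq : q ∈ K.support ⟨.Z, j⟩
      · simp only [hq, true_and, if_true]
        -- The CNOT with `q` is past and already counted, happens now and adds its term, or is still
        -- to come.
        rcases lt_trichotomy (S.cnotTime ⟨.Z, j⟩ q r + 1) t with h | h | h
        · rw [if_pos h, if_neg h.ne', if_pos (by omega), add_zero]
        · rw [if_neg h.not_lt, if_pos h.symm, if_pos (by omega), zero_add, h]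
        · rw [if_neg (by omega), if_neg (by omega), if_neg (by omega), add_zero]
      · simp [hq]
    · intro c _
      rw [if_neg]
      rw [cnot_inr_Z_mem_iff]
      rintro ⟨q, h, -⟩
      cases h
    · rintro ⟨b', h⟩
      obtain ⟨-, r', hr', h⟩ := (prep_inr_mem_iff _ _).1 h
      have := S.prep_lt_meas ⟨.Z, j⟩
      rcases lt_trichotomy r r' with h' | rfl | h'
      · have := S.start_add_meas_lt ⟨.Z, j⟩ h'
        omega
      · omega
      · have := S.start_add_meas_lt ⟨.Z, j⟩ h'
        omega

theorem frame_Z_ancilla_meas (e : Mechanism (S.memoryCircuit b m)) (j : R .Z)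
    (he : e.error .X (.inr ⟨.Z, j⟩) = 0) {r : ℕ} (hr : r < m) :
    e.frame (S.start r + S.meas ⟨.Z, j⟩ + 1) .X (.inr ⟨.Z, j⟩) =
      ∑ q, K.H .Z j q * e.frame (S.cnotTime ⟨.Z, j⟩ q r + 1) .X (.inl q) := by
  have := S.prep_lt_meas ⟨.Z, j⟩
  rw [frame_Z_ancilla e j he hr (by omega) le_rfl]
  refine Finset.sum_congr rfl fun q _ => ?_
  split_ifs with h
  · rfl
  -- All CNOTs of the support precede the measurement. Elsewhere `S.cnot` is an arbitrary value, but
  -- the matrix entry vanishes.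
  · have hq : q ∉ K.support ⟨.Z, j⟩ := by
      intro hq
      have := S.cnot_lt_meas _ q hq
      unfold cnotTime at h
      omega
    have h01 : ∀ y : ZMod 2, y ≠ 1 → 0 = y := by decide
    rw [← h01 _ hq, zero_mul]

/-! ### Faults of the first round and what they flip -/

open Classical in
/-- An `X` error on the qubit `x` after the CNOT of the first round between the ancilla of the
`X`-check `i` and the data qubit `q`. -/
noncomputable def firstRoundFault (S : SEC K) (hm : 0 < m) (i : R .X) (q : Q)
    (hq : q ∈ K.support ⟨.X, i⟩) (x : K.Qubit) (hx : x = .inr ⟨.X, i⟩ ∨ x = .inl q) :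
    Mechanism (S.memoryCircuit .Z m) where
  time := S.cnotTime ⟨.X, i⟩ q 0 + 1
  gate := .cnot (.inr ⟨.X, i⟩) (.inl q)
  mem := .inl (.cnotX i q 0 hm hq)
  error
    | .X => Pi.single x 1
    | .Z => 0
  isFault := by
    refine ⟨fun h => ?_, fun b => ?_⟩
    · have := congrFun (congrFun h .X) x
      simp at this
    · cases b
      · intro v hv
        have : v = x := by
          by_contra h
          exact hv (Pi.single_eq_of_ne h _)
        subst this
        exact hx
      · simp

open Classical in
/-- The data error caused by `firstRoundFault`: a single error, or the errors spread by the
remaining CNOTs of the ancilla. -/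
noncomputable def faultPattern (S : SEC K) (i : R .X) (q : Q) (x : K.Qubit) (q' : Q) : ZMod 2 :=
  if x = .inl q' ∨ x = .inr ⟨.X, i⟩ ∧ q' ∈ K.support ⟨.X, i⟩ ∧
    S.cnot ⟨.X, i⟩ q < S.cnot ⟨.X, i⟩ q' then 1 else 0

section

variable {hm : 0 < m} {i : R .X} {q : Q} {hq : q ∈ K.support ⟨.X, i⟩} {x : K.Qubit}
  {hx : x = .inr ⟨.X, i⟩ ∨ x = .inl q}

/-- `X`-ancillas are never CNOT targets, so no `X` error can spread to them. -/
theorem firstRoundFault_frame_of_ne (t : ℕ) {i' : R .X} (hi : i' ≠ i) :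
    (S.firstRoundFault hm i q hq x hx).frame t .X (.inr ⟨.X, i'⟩) = 0 := by
  classical
  have hxi : (.inr ⟨.X, i'⟩ : K.Qubit) ≠ x := by
    rcases hx with rfl | rfl <;> simp [hi]
  induction t with
  | zero => rfl
  | succ t ih =>
    rw [frame_X_ancilla_succ, ih, ite_self, zero_add]
    simp [firstRoundFault, Pi.single_eq_of_ne hxi]

open Classical in
theorem firstRoundFault_frame_ancilla {t : ℕ} (h1 : S.cnotTime ⟨.X, i⟩ q 0 + 1 < t)
    (h2 : t ≤ S.start 0 + S.meas ⟨.X, i⟩ + 1) :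
    (S.firstRoundFault hm i q hq x hx).frame t .X (.inr ⟨.X, i⟩) =
      if x = .inr ⟨.X, i⟩ then 1 else 0 := by
  have hprep : ∀ t, S.cnotTime ⟨.X, i⟩ q 0 + 1 ≤ t → t ≤ S.start 0 + S.meas ⟨.X, i⟩ + 1 →
      ¬ ∃ r < m, t = S.start r + S.prep ⟨.X, i⟩ + 1 := by
    rintro t h1 h2 ⟨r, -, rfl⟩
    have := S.prep_lt_cnot _ q hq
    unfold cnotTime at h1
    rcases Nat.eq_zero_or_pos r with rfl | hr
    · omega
    · have := S.start_add_meas_lt ⟨.X, i⟩ hr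
      omega
  induction t, h1 using Nat.le_induction with
  | base =>
    rw [frame_X_ancilla_succ, if_neg (hprep _ le_rfl (by omega)),
      show (S.firstRoundFault hm i q hq x hx).frame (S.cnotTime ⟨.X, i⟩ q 0 + 1) = 0 from
        Mechanism.frame_eq_zero _ le_rfl]
    simp [firstRoundFault, Pi.single_apply, eq_comm]
  | succ t h1 ih =>
    rw [frame_X_ancilla_succ, if_neg (hprep _ (by omega) (by omega)), ih (by omega)]
    simp [firstRoundFault, show t ≠ S.cnotTime ⟨.X, i⟩ q 0 + 1 by omega]

/-- The preparation of the next round erases the ancilla error, so the fault spreads only within the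
first round. -/
theorem firstRoundFault_frame_ancilla_of_pos {r t : ℕ} (hr : 0 < r) (hrm : r < m)
    (ht : S.start r + S.prep ⟨.X, i⟩ + 1 < t) :
    (S.firstRoundFault hm i q hq x hx).frame t .X (.inr ⟨.X, i⟩) = 0 := by
  have h3 := S.start_add_meas_lt ⟨.X, i⟩ hr
  have h4 := S.cnot_lt_meas _ q hq
  have herr : ∀ t, S.start r + S.prep ⟨.X, i⟩ + 1 ≤ t →
      t ≠ (S.firstRoundFault hm i q hq x hx).time := by
    rintro t ht rfl
    simp only [firstRoundFault, cnotTime] at ht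
    omega
  induction t, ht using Nat.le_induction with
  | base =>
    rw [frame_X_ancilla_succ, if_pos ⟨r, hrm, rfl⟩, if_neg (herr _ le_rfl), add_zero]
  | succ t h1 ih =>
    rw [frame_X_ancilla_succ, ih, ite_self, if_neg (herr _ (by omega)), add_zero]

/-- The contribution of a fault to the error on a data qubit arises at the time of the CNOT of the
check `i` on that qubit. -/
theorem firstRoundFault_frame_data (t : ℕ) (q' : Q) :
    (S.firstRoundFault hm i q hq x hx).frame t .X (.inl q') =
      if S.cnotTime ⟨.X, i⟩ q' 0 + 1 < t then S.faultPattern i q x q' else 0 := by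
  classical
  set e := S.firstRoundFault hm i q hq x hx with he
  induction t with
  | zero => simp; rfl
  | succ t ih =>
    -- Data qubits are prepared at step 0 only; afterwards nothing erases their errors.
    rcases Nat.eq_zero_or_pos t with rfl | ht
    · rw [Mechanism.frame_eq_zero e (by simp [he, firstRoundFault]), if_neg (by omega)]
      rfl
    have hsum : (∑ c, if Gate.cnot c (.inl q') ∈ S.memoryCircuit .Z m t then e.frame t .X c else 0)
        = if t = S.cnotTime ⟨.X, i⟩ q' 0 + 1 ∧ x = .inr ⟨.X, i⟩ ∧ q' ∈ K.support ⟨.X, i⟩ ∧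
          S.cnot ⟨.X, i⟩ q < S.cnot ⟨.X, i⟩ q' then 1 else 0 := by
      rw [Finset.sum_eq_single (.inr ⟨.X, i⟩)]
      · split_ifs with h1 h2 h2
        · obtain ⟨rfl, hxi, hq', hlt⟩ := h2
          have := S.cnot_lt_meas _ q' hq'
          rw [he, firstRoundFault_frame_ancilla (by unfold cnotTime; omega)
            (by unfold cnotTime; omega), if_pos hxi]
        · obtain ⟨i', hi', hq', r, hr, rfl⟩ := (cnot_inl_mem_iff _ _).1 h1
          cases hi'
          have h5 := S.prep_lt_cnot _ q' hq'
          have h6 := S.cnot_lt_meas _ q' hq'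
          rcases Nat.eq_zero_or_pos r with rfl | hr0
          -- CNOTs of the check up to the faulty one see an ancilla still free of error.
          · by_cases hlt : S.cnot ⟨.X, i⟩ q < S.cnot ⟨.X, i⟩ q'
            · rw [he, firstRoundFault_frame_ancilla (by unfold cnotTime; omega)
                (by unfold cnotTime; omega), if_neg]
              exact fun h => h2 ⟨rfl, h, hq', hlt⟩
            · rw [Mechanism.frame_eq_zero e]
              · rfl
              · simp only [he, firstRoundFault, cnotTime]
                omega
          · exact firstRoundFault_frame_ancilla_of_pos hr0 hr (by unfold cnotTime; omega)
        · exact absurd ((cnot_inl_mem_iff _ _).2 ⟨i, rfl, h2.2.2.1, 0, hm, h2.1⟩) h1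
        · rfl
      · intro c _ hc
        split_ifs with h
        · obtain ⟨i', rfl, -⟩ := (cnot_inl_mem_iff _ _).1 h
          exact firstRoundFault_frame_of_ne t fun h => hc (by rw [h])
        · rfl
      · simp
    have herr : (if t = e.time then e.error .X (.inl q') else 0) =
        if t = S.cnotTime ⟨.X, i⟩ q' 0 + 1 ∧ x = .inl q' then 1 else 0 := by
      -- A direct data error sits on `q` itself, so its time is again that of the CNOT of `i` on the
      -- affected qubit.
      have hxq : x = .inl q' → q' = q := by
        rintro rfl
        rcases hx with h | h
        · cases h
        · exact Sum.inl_injective h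
      by_cases h : x = .inl q'
      · cases hxq h
        simp [he, firstRoundFault, h]
      · simp [he, firstRoundFault, h]
    rw [e.frame_succ_X, if_neg, ih, hsum, herr]
    · rcases lt_trichotomy t (S.cnotTime ⟨.X, i⟩ q' 0 + 1) with h | h | h
      · simp [show ¬ S.cnotTime ⟨.X, i⟩ q' 0 + 1 < t by omega, h.ne,
          show ¬ S.cnotTime ⟨.X, i⟩ q' 0 + 1 < t + 1 by omega]
      · have h1 : ¬ S.cnotTime ⟨.X, i⟩ q' 0 + 1 < t := by omega
        have h2 : S.cnotTime ⟨.X, i⟩ q' 0 + 1 < t + 1 := by omega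
        rw [if_neg h1, if_pos h2, zero_add, faultPattern]
        simp only [h, true_and]
        by_cases h' : x = .inl q'
        · simp [h']
        · simp [h']
      · simp [h, h.ne', h.trans (Nat.lt_succ_self t)]
    · rintro ⟨b', h⟩
      have := (prep_inl_mem_iff _ _).1 h
      omega

theorem firstRoundFault_dataFlip (q' : Q) :
    dataFlip (S.firstRoundFault hm i q hq x hx) q' = S.faultPattern i q x q' := by
  have hfin : q' ∈ K.support ⟨.X, i⟩ → S.cnotTime ⟨.X, i⟩ q' 0 + 1 < S.finish m := by
    intro hq'
    have h1 := S.cnot_lt_meas _ q' hq'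
    have h2 : S.start 0 + S.meas ⟨.X, i⟩ ≤
        (Finset.range m).sup fun r => Finset.univ.sup fun c => S.start r + S.meas c :=
      (Finset.le_sup (f := fun c => S.start 0 + S.meas c) (Finset.mem_univ _)).trans
        (Finset.le_sup (f := fun r => Finset.univ.sup fun c => S.start r + S.meas c)
          (Finset.mem_range.2 hm))
    unfold cnotTime finish
    omega
  rw [dataFlip, Mechanism.outcomeFlip, if_neg (by simp [firstRoundFault]), add_zero]
  change (S.firstRoundFault hm i q hq x hx).frame _ .X _ = _
  rw [firstRoundFault_frame_data]
  split_ifs with h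
  · rfl
  · rw [faultPattern, if_neg]
    rintro (rfl | h')
    · rcases hx with h' | h'
      · cases h'
      · cases h'
        exact h (hfin hq)
    · exact h (hfin h'.2.1)

/-- Only a `Z` factor or a measurement failure can flip an `X`-measurement, and this fault involves
neither. -/
theorem firstRoundFault_outcomeFlip_X (t : ℕ) (i' : R .X) :
    (S.firstRoundFault hm i q hq x hx).outcomeFlip t .X (.inr ⟨.X, i'⟩) = 0 := by
  rw [Mechanism.outcomeFlip, if_neg (by simp [firstRoundFault]), add_zero]
  change (S.firstRoundFault hm i q hq x hx).frame t .Z _ = 0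
  rw [Mechanism.frame_Z_eq_zero _ rfl]
  rfl

open Classical in
/-- In a non-interleaved circuit, a round of `Z`-checks sees either the whole data error or none of
it. -/
theorem firstRoundFault_outcomeFlip_Z (hS : S.NonInterleaved) {r : ℕ} (hr : r < m) (j : R .Z) :
    (S.firstRoundFault hm i q hq x hx).outcomeFlip (S.start r + S.meas ⟨.Z, j⟩ + 1) .Z
      (.inr ⟨.Z, j⟩) =
      if S.Precedes .X 0 r then ∑ q', K.H .Z j q' * S.faultPattern i q x q' else 0 := by
  -- `Precedes` only compares CNOTs on a common data qubit, so the error must lie in the support of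
  -- `i`.
  have hpat : ∀ q', S.faultPattern i q x q' ≠ 0 → q' ∈ K.support ⟨.X, i⟩ := by
    intro q' h
    rw [faultPattern, ite_ne_right_iff] at h
    rcases h.1 with rfl | h
    · rcases hx with h' | h'
      · cases h'
      · cases h'
        exact hq
    · exact h.2.1
  have h01 : ∀ y : ZMod 2, y = 0 ∨ y = 1 := by decide
  rw [Mechanism.outcomeFlip, if_neg (by simp [firstRoundFault]), add_zero]
  change (S.firstRoundFault hm i q hq x hx).frame _ .X _ = _
  rw [frame_Z_ancilla_meas _ _ _ hr]
  · simp only [firstRoundFault_frame_data]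
    have key : ∀ q', K.H .Z j q' * (if S.cnotTime ⟨.X, i⟩ q' 0 + 1 <
        S.cnotTime ⟨.Z, j⟩ q' r + 1 then S.faultPattern i q x q' else 0) =
        if S.Precedes .X 0 r then K.H .Z j q' * S.faultPattern i q x q' else 0 := by
      intro q'
      rcases h01 (K.H .Z j q') with h | h
      · simp [h]
      by_cases h' : S.faultPattern i q x q' = 0
      · simp [h']
      by_cases hp : S.Precedes .X 0 r
      · have hlt : S.cnotTime ⟨.X, i⟩ q' 0 < S.cnotTime ⟨.Z, j⟩ q' r :=
          hp i j q' (hpat q' h') h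
        rw [if_pos hp, if_pos (Nat.succ_lt_succ hlt)]
      · have hlt : S.cnotTime ⟨.Z, j⟩ q' r < S.cnotTime ⟨.X, i⟩ q' 0 :=
          ((hS 0 r).resolve_left hp) j i q' h (hpat q' h')
        rw [if_neg hp, if_neg (by omega), mul_zero]
    rw [Finset.sum_congr rfl fun q' _ => key q']
    split_ifs
    · rfl
    · exact Finset.sum_const_zero
  · change (Pi.single x 1 : K.Qubit → ZMod 2) (.inr ⟨.Z, j⟩) = 0
    refine Pi.single_eq_of_ne ?_ _
    rcases hx with rfl | rfl <;> simp

end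

/-! ### From undetected faults to a bound on the distance -/

/-- Faults of the CNOTs of the first round of `X`-checks, on qubits `s`, which together leave an
error on the data qubits that commutes with all checks but not with the logical operator `w`. -/
theorem basisDistance_Z_le_card (hS : S.NonInterleaved) (hm : 0 < m) (s : Finset K.Qubit)
    (i : K.Qubit → R .X) (q : K.Qubit → Q) (hq : ∀ x ∈ s, q x ∈ K.support ⟨.X, i x⟩)
    (hx : ∀ x ∈ s, x = .inr ⟨.X, i x⟩ ∨ x = .inl (q x)) {v w : Q → ZMod 2}
    (hv : ∀ q', ∑ x ∈ s, S.faultPattern (i x) (q x) x q' = v q')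
    (hvZ : (K.H .Z).mulVec v = 0) (hw : w ∈ K.logicals .Z) (hwv : ∑ q', w q' * v q' ≠ 0) :
    S.basisDistance .Z m ≤ s.card := by
  classical
  let f : s → Mechanism (S.memoryCircuit .Z m) := fun x =>
    S.firstRoundFault hm (i x) (q x) (hq x x.2) x (hx x x.2)
  -- The position of the inserted error recovers `x`.
  have hf : Function.Injective f := by
    intro x y h
    have h' := congrFun (congrFun (congrArg Mechanism.error h) .X) x
    change (Pi.single (x : K.Qubit) 1 : K.Qubit → ZMod 2) x =
      (Pi.single (y : K.Qubit) 1 : K.Qubit → ZMod 2) x at h'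
    by_contra hne
    rw [Pi.single_eq_same, Pi.single_eq_of_ne fun h => hne (Subtype.ext h)] at h'
    exact one_ne_zero h'
  have hlin : ∀ u : Q → ZMod 2, (∑ x : s, ∑ q', u q' * S.faultPattern (i x) (q x) x q') =
      ∑ q', u q' * v q' := by
    intro u
    rw [Finset.sum_comm]
    refine Finset.sum_congr rfl fun q' _ => ?_
    rw [← Finset.mul_sum, ← hv q',
      Finset.sum_coe_sort s fun x => S.faultPattern (i x) (q x) x q']
  have hsyn : ∀ j : R .Z, (∑ x : s, ∑ q', K.H .Z j q' * S.faultPattern (i x) (q x) x q') = 0 :=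
    fun j => (hlin _).trans (congrFun hvZ j)
  have hE : IsCircuitLogical (Finset.univ.map ⟨f, hf⟩) := by
    refine ⟨fun c k hk => ?_, w, hw, ?_⟩
    · rw [Finset.sum_map]
      obtain ⟨_ | _, j⟩ := c
      · rw [IsDetector, if_neg (by simp)] at hk
        obtain ⟨k, rfl⟩ := Nat.exists_eq_succ_of_ne_zero (Nat.one_le_iff_ne_zero.1 hk.1)
        refine Finset.sum_eq_zero fun x _ => ?_
        rw [detectorFlip, syndromeFlip, syndromeFlip, if_pos hk.2, if_pos (by omega)]
        have h0 : ∀ t, (f x).outcomeFlip t .X (.inr ⟨.X, j⟩) = 0 := fun t =>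
          firstRoundFault_outcomeFlip_X t j
        exact (congrArg₂ (· + ·) (h0 _) (h0 _)).trans (add_zero 0)
      -- Not only the detectors but all values of a `Z`-check are unflipped in total. The condition
      -- `S.Precedes .X 0 r` does not depend on the fault, so in each round the sum is the syndrome
      -- of `v` or empty.
      · have key : ∀ k, ∑ x : s, syndromeFlip (f x) ⟨.Z, j⟩ k = 0 := by
          intro k
          rcases k with _ | k
          · exact Finset.sum_const_zero
          · by_cases hk : k < m
            · simp only [syndromeFlip, hk, if_true, f, firstRoundFault_outcomeFlip_Z hS hk]
              split_ifs
              · exact hsyn j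
              · exact Finset.sum_const_zero
            · simp only [syndromeFlip, hk, if_false, f, firstRoundFault_dataFlip]
              exact hsyn j
        change ∑ x : s, (syndromeFlip (f x) ⟨.Z, j⟩ (k + 1) + syndromeFlip (f x) ⟨.Z, j⟩ k) = 0
        rw [Finset.sum_add_distrib, key, key, add_zero]
    · rw [Finset.sum_map]
      change ∑ x : s, observableFlip (f x) w ≠ 0
      simp only [observableFlip, f, firstRoundFault_dataFlip]
      rwa [hlin]
  refine (iInf₂_le _ hE).trans ?_
  simp

/-- If the last CNOTs of an `X`-check, those after its CNOT with `p`, act on part of the support of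
an `X`-type logical operator `v`, then a fault of the CNOT with `p` replaces these errors. -/
theorem basisDistance_Z_le_of_hook (hS : S.NonInterleaved) (hm : 0 < m)
    (hcov : ∀ q, ∃ i, q ∈ K.support ⟨.X, i⟩) {i : R .X} {p : Q} (hp : p ∈ K.support ⟨.X, i⟩)
    {hook V : Finset Q} (hsub : hook ⊆ V)
    (hhook : ∀ q, q ∈ hook ↔ q ∈ K.support ⟨.X, i⟩ ∧ S.cnot ⟨.X, i⟩ p < S.cnot ⟨.X, i⟩ q)
    (hV : ∀ j, ∑ q ∈ V, K.H .Z j q = 0) {w : Q → ZMod 2} (hw : (K.H .X).mulVec w = 0)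
    (hwV : ∑ q ∈ V, w q ≠ 0) :
    S.basisDistance .Z m ≤ ((V.card - hook.card + 1 : ℕ) : ℕ∞) := by
  classical
  -- A data error on `q` is placed after a CNOT with `g q`, so that its timing too is governed by
  -- non-interleaving.
  choose g hg using hcov
  have hsum : ∀ u : Q → ZMod 2, (∑ q, u q * if q ∈ V then 1 else 0) = ∑ q ∈ V, u q := by
    intro u
    simp [Finset.sum_ite_mem]
  have hcard : ((V \ hook).disjSum ({⟨.X, i⟩} : Finset K.Check)).card
      = V.card - hook.card + 1 := by
    rw [Finset.card_disjSum, Finset.card_sdiff_of_subset hsub, Finset.card_singleton]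
  rw [← hcard]
  refine basisDistance_Z_le_card hS hm _ (Sum.elim g fun _ => i) (Sum.elim id fun _ => p)
    (v := fun q => if q ∈ V then 1 else 0) (w := w) ?_ ?_ ?_ ?_ ⟨hw, ?_⟩ ?_
  · rintro (q | c) -
    · exact hg q
    · exact hp
  · rintro (q | c) h
    · exact .inr rfl
    · left
      rw [Finset.inr_mem_disjSum, Finset.mem_singleton] at h
      rw [h]
      rfl
  · intro q'
    rw [Finset.sum_disjSum, Finset.sum_singleton]
    simp only [faultPattern, Sum.elim_inl, Sum.elim_inr, reduceCtorEq, false_and, or_false,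
      false_or, true_and, Sum.inl.injEq, ← hhook, Finset.sum_ite_eq', Finset.mem_sdiff]
    by_cases h1 : q' ∈ hook
    · simp [h1, hsub h1]
    · simp [h1]
  · funext j
    exact (hsum _).trans (hV j)
  · intro hspan
    -- Summation over `V` is a functional that vanishes on all `Z`-checks but not on `w`.
    have hle : Submodule.span (ZMod 2) (Set.range (K.H .Z)) ≤
        LinearMap.ker (∑ q ∈ V, LinearMap.proj (R := ZMod 2) (φ := fun _ : Q => ZMod 2) q) := by
      rw [Submodule.span_le]
      rintro _ ⟨j, rfl⟩
      simpa using hV j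
    exact hwV (by simpa using hle hspan)
  · rwa [hsum]

end SEC

/-! ### The bound for the gross code -/

/-- The two largest elements of a set, together with the next one. -/
theorem exists_filter_lt_eq_pair {α : Type*} [DecidableEq α] (s : Finset α) (f : α → ℕ)
    (hf : Set.InjOn f s) (hs : 3 ≤ s.card) :
    ∃ p ∈ s, ∃ a ∈ s, ∃ b ∈ s, a ≠ b ∧ ∀ q, (q = a ∨ q = b) ↔ q ∈ s ∧ f p < f q := by
  obtain ⟨a, ha, hamax⟩ := s.exists_max_image f (Finset.card_pos.1 (by omega))
  have h1 : (s.erase a).card = s.card - 1 := Finset.card_erase_of_mem ha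
  obtain ⟨b, hb, hbmax⟩ := (s.erase a).exists_max_image f (Finset.card_pos.1 (by omega))
  have h2 : ((s.erase a).erase b).card = s.card - 1 - 1 := by
    rw [Finset.card_erase_of_mem hb, h1]
  obtain ⟨p, hp, hpmax⟩ := ((s.erase a).erase b).exists_max_image f
    (Finset.card_pos.1 (by omega))
  simp only [Finset.mem_erase] at hb hp hbmax hpmax
  refine ⟨p, hp.2.2, a, ha, b, hb.2, hb.1.symm, fun q => ⟨?_, fun ⟨hq, hlt⟩ => ?_⟩⟩
  · rintro (rfl | rfl)
    · exact ⟨ha, lt_of_le_of_ne (hamax p hp.2.2) fun h => hp.2.1 (hf hp.2.2 ha h)⟩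
    · exact ⟨hb.2, lt_of_le_of_ne (hbmax p hp.2) fun h => hp.1 (hf hp.2.2 hb.2 h)⟩
  · by_contra! h
    exact absurd (hpmax q ⟨h.2, h.1, hq⟩) (by omega)

/-- The circuit distance of the gross code in the `Z`-basis experiment. -/
theorem gross_basisDistance_Z_le (S : SEC grossCode) (hS : S.NonInterleaved) {m : ℕ}
    (hm : 0 < m) : S.basisDistance .Z m ≤ 11 := by
  -- Here `a` and `b` are the qubits of the last two CNOTs of the check at the origin, and the
  -- faulty CNOT is the one with `p` just before them.
  obtain ⟨p, hp, a, ha, b, hb, hab, hook⟩ :=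
    exists_filter_lt_eq_pair grossRow.toFinset (S.cnot ⟨.X, (0, 0)⟩)
      (fun q hq q' hq' h => S.ancilla_inj ⟨.X, (0, 0)⟩
        ((grossCode_mem_support_iff q).2 (List.mem_toFinset.1 hq))
        ((grossCode_mem_support_iff q').2 (List.mem_toFinset.1 hq')) h) (by decide +kernel)
  simp only [List.mem_toFinset, ← grossCode_mem_support_iff] at hp hook
  obtain ⟨V, hV, haV, hbV⟩ :=
    grossLogicalsX_pair a (List.mem_toFinset.1 ha) b (List.mem_toFinset.1 hb) hab
  obtain ⟨hnd, hlen⟩ := grossLogicalsX_nodup V hV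
  have key := SEC.basisDistance_Z_le_of_hook (V := V.toFinset) (hook := {a, b})
    (w := fun q => if q ∈ grossLogicalZ then 1 else 0) hS hm grossCode_exists_mem_support hp ?_ ?_
    ?_ ?_ ?_
  -- The count is 12 - 2 + 1 = 11.
  · rw [List.toFinset_card_of_nodup hnd, hlen, Finset.card_pair hab] at key
    exact key
  · intro q hq
    rw [Finset.mem_insert, Finset.mem_singleton] at hq
    rw [List.mem_toFinset]
    rcases hq with rfl | rfl <;> assumption
  · intro q
    rw [Finset.mem_insert, Finset.mem_singleton, hook]
  · intro j
    rw [List.sum_toFinset _ hnd]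
    exact grossLogicalsX_check V hV j
  · funext i
    change ∑ q, grossCode.H .X i q * (if q ∈ grossLogicalZ then 1 else 0) = 0
    have h := List.sum_toFinset (fun q => grossCode.H .X i q) grossLogicalZ_nodup
    rw [grossLogicalZ_check] at h
    refine Eq.trans ?_ h
    simp only [mul_ite, mul_one, mul_zero, ← List.mem_toFinset, Finset.sum_ite_mem,
      Finset.univ_inter]
  · rw [List.sum_toFinset _ hnd]
    exact grossLogicals_odd V hV

end SyndromeExtraction

theorem mainTheorem2 (S : SyndromeExtraction.SEC SyndromeExtraction.grossCode)
    (hS : S.NonInterleaved) (m : ℕ) (hm : 1 ≤ m) : S.circuitDistance m ≤ 11 :=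
  (min_le_right _ _).trans (SyndromeExtraction.gross_basisDistance_Z_le S hS hm)
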